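/- Let $G$ be a finite, simple, connected, non-complete graph with minimum degree $\delta(G)\ge 2$. The proper connection number $pc(G)$ is the least number of colors in an edge-coloring of $G$ (adjacent edges may have the same color) for which any two distinct vertices are joined by a path no two adjacent edges of which have the same color. (i) If $G$ is an interval graph (the intersection graph of a family of intervals of the real line), then $pc(G)\le 4$. (ii) If $G$ is AT-free, then $pc(G)\le 4$. Here $G$ is AT-free if it has no asteroidal triple, that is, no three distinct pairwise non-adjacent vertices such that any two of them are joined by a path containing no neighbor of the third. (iii) If $G$ is a circular arc graph (the intersection graph of a family of arcs of a circle), then $pc(G)\le 4$. (iv) If $G$ is a threshold graph, that is, if there are $w:V(G)\to\mathbb{R}$ and $t\in\mathbb{R}$ such that any two distinct vertices $u,v$ are adjacent if and only if $w(u)+w(v)\ge t$, then $pc(G)=2$. -/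

import Mathlib

namespace ProperConnection

variable {V : Type*} (G : SimpleGraph V)

/-- A proper path of `G` under the edge-colouring `c`: a path on which any two distinct
edges that share an endpoint have different colours. -/
def IsProperPath {G : SimpleGraph V} {K : Type*} (c : G.edgeSet → K) {u v : V}
    (p : G.Walk u v) : Prop :=
  p.IsPath ∧
    ∀ e f : G.edgeSet, (e : Sym2 V) ∈ p.edges → (f : Sym2 V) ∈ p.edges → e ≠ f →
      (∃ x : V, x ∈ (e : Sym2 V) ∧ x ∈ (f : Sym2 V)) → c e ≠ c f

/-- Every pair of distinct vertices is joined by a proper path. -/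
def IsProperPathColoring {G : SimpleGraph V} {K : Type*} (c : G.edgeSet → K) : Prop :=
  ∀ u v : V, u ≠ v → ∃ p : G.Walk u v, IsProperPath c p

/-- The proper connection number: the least number of colours available to a
proper-path colouring. For a finite connected graph the set is nonempty, see
`exists_isProperPathColoring`. -/
noncomputable def pc : ℕ :=
  sInf {k : ℕ | ∃ c : G.edgeSet → Fin k, IsProperPathColoring c}

/-- A finite connected graph has a proper-path colouring, so `pc` is an honest minimum. -/
theorem exists_isProperPathColoring [Finite V] (hG : G.Connected) :
    ∃ k : ℕ, ∃ c : G.edgeSet → Fin k, IsProperPathColoring c := by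
  obtain ⟨k, ⟨c⟩⟩ := Finite.exists_equiv_fin G.edgeSet
  refine ⟨k, c, fun u v _ => ?_⟩
  obtain ⟨p, hp⟩ := hG.exists_isPath u v
  exact ⟨p, hp, fun e f _ _ hef _ h => hef (c.injective h)⟩

/-- `G` is the intersection graph of the family `S`, indexed by the vertices. -/
def IsIntersectionGraphOf {X : Type*} (S : V → Set X) : Prop :=
  ∀ u v : V, u ≠ v → (G.Adj u v ↔ (S u ∩ S v).Nonempty)

/-- A nonempty interval of the real line (open, closed, half-open, unbounded or a point). -/
def IsRealInterval (I : Set ℝ) : Prop :=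
  I.Nonempty ∧ I.OrdConnected

/-- An arc of the unit circle: the image of a nonempty real interval under `t ↦ exp (i t)`. -/
def IsArc (A : Set Circle) : Prop :=
  ∃ I : Set ℝ, IsRealInterval I ∧ A = Circle.exp '' I

/-- Interval graphs. -/
def IsIntervalGraph : Prop :=
  ∃ S : V → Set ℝ, (∀ v, IsRealInterval (S v)) ∧ IsIntersectionGraphOf G S

/-- Circular arc graphs. -/
def IsCircularArcGraph : Prop :=
  ∃ S : V → Set Circle, (∀ v, IsArc (S v)) ∧ IsIntersectionGraphOf G S

/-- There is a path from `x` to `y` that contains no neighbour of `z`. -/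
def PathAvoidingNeighbors (x y z : V) : Prop :=
  ∃ p : G.Walk x y, p.IsPath ∧ ∀ w ∈ p.support, ¬ G.Adj z w

/-- `x, y, z` are an asteroidal triple: three distinct, pairwise non-adjacent vertices such
that any two of them are joined by a path containing no neighbour of the third. -/
def IsAsteroidalTriple (x y z : V) : Prop :=
  x ≠ y ∧ y ≠ z ∧ x ≠ z ∧ ¬ G.Adj x y ∧ ¬ G.Adj y z ∧ ¬ G.Adj x z ∧
    PathAvoidingNeighbors G x y z ∧ PathAvoidingNeighbors G y z x ∧
    PathAvoidingNeighbors G x z y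

/-- AT-free graphs. -/
def IsATFree : Prop :=
  ∀ x y z : V, ¬ IsAsteroidalTriple G x y z

/-- Threshold graphs. -/
def IsThresholdGraph : Prop :=
  ∃ (w : V → ℝ) (t : ℝ), ∀ u v : V, u ≠ v → (G.Adj u v ↔ t ≤ w u + w v)

end ProperConnection

/-!
Interval graphs, AT-free graphs and circular arc graphs all have a dominating path, and a graph of
minimum degree at least two with a dominating path has proper connection number at most four.

*Colouring* (`pc_le_four_of_hasDominatingPath`). Let `D` be the vertex set of the path. Its edges
alternate between the colours `0` and `1`, so any two of its vertices are joined by a proper path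
inside `D`. The colours `2` and `3` are kept for the edges between `D` and the rest. Take a maximal
independent set `X` outside `D`: edges from `X` into `D` get colour `2`, edges into `D` from the
other outside vertices get colour `3`, and a vertex with no neighbour outside `D`, which has two
neighbours in `D` by the degree condition, gets one edge of each colour. Every outside vertex with
an outside neighbour has one on the other side of the partition, so every outside vertex can enter
`D` in both colours, and two outside vertices are joined through `D` with colour `2` at one end and
colour `3` at the other (`isProperPathColoring_of_exits`).

*AT-free graphs* (`IsATFree.hasDominatingPath`). Call `u` admissible if no two vertices are each
reachable from `u` off the closed neighbourhood of the other. A vertex that maximizes a weight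
favouring large components of the complement of its closed neighbourhood is admissible
(`IsATFree.exists_admissible`). Given such a `u`, a vertex `v` for which the component of `u` in
`G - N[v]` is largest forms a dominating pair with `u`: every path from `u` to `v` dominates.
Interval graphs are AT-free because the middle one of three disjoint intervals separates the
other two.

*Circular arc graphs* (`IsCircularArcGraph.hasDominatingPath`). Lift the arcs to the line. Either
some arc has two lifts in the same component of the intersection graph of all lifts, and a shortest
walk between two such lifts covers a full turn and projects to a dominating path; or each component
of the lift is a copy of `G`, which is then an interval graph.

*Threshold graphs*. Two neighbours of a vertex of least weight are adjacent to all vertices, and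
then two colours suffice (`pc_le_two_of_universal`); a non-complete graph needs two (`two_le_pc`).
-/

namespace ProperConnection

variable {V : Type*} {G : SimpleGraph V}

/-! ### Proper paths -/

theorem IsProperPath.nil {K : Type*} (c : G.edgeSet → K) (u : V) :
    IsProperPath c (SimpleGraph.Walk.nil : G.Walk u u) :=
  ⟨SimpleGraph.Walk.IsPath.nil, fun e _ he => by simp at he⟩

theorem IsProperPath.reverse {K : Type*} {c : G.edgeSet → K} {u v : V} {p : G.Walk u v}
    (hp : IsProperPath c p) : IsProperPath c p.reverse :=
  ⟨hp.1.reverse, fun e f he hf => hp.2 e f (by simpa using he) (by simpa using hf)⟩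

/-- The colour condition only concerns the edges of `p` at its first vertex, because the new
vertex `u` lies on no edge of `p`. -/
theorem IsProperPath.cons {K : Type*} {γ : Sym2 V → K} {u v w : V} {p : G.Walk v w}
    (hp : IsProperPath (fun e : G.edgeSet => γ e) p) (h : G.Adj u v) (hu : u ∉ p.support)
    (hc : ∀ e ∈ p.edges, v ∈ e → γ e ≠ γ s(u, v)) :
    IsProperPath (fun e : G.edgeSet => γ e) (SimpleGraph.Walk.cons h p) := by
  have key : ∀ e ∈ p.edges, (∃ x, x ∈ s(u, v) ∧ x ∈ e) → γ e ≠ γ s(u, v) := by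
    rintro e he ⟨x, hx, hxe⟩
    rcases Sym2.mem_iff.1 hx with rfl | rfl
    · exact absurd (SimpleGraph.Walk.mem_support_of_mem_edges he hxe) hu
    · exact hc e he hxe
  refine ⟨hp.1.cons hu, ?_⟩
  rintro ⟨e, he⟩ ⟨f, hf⟩ hep hfp hef ⟨x, hxe, hxf⟩
  simp only [SimpleGraph.Walk.edges_cons, List.mem_cons] at hep hfp hxe hxf
  rcases hep with rfl | hep <;> rcases hfp with rfl | hfp
  · exact absurd rfl hef
  · exact (key f hfp ⟨x, hxe, hxf⟩).symm
  · exact key e hep ⟨x, hxf, hxe⟩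
  · exact hp.2 ⟨e, he⟩ ⟨f, hf⟩ hep hfp hef ⟨x, hxe, hxf⟩

/-! ### Four colours suffice for a graph with a dominating path -/

variable (G) in
/-- Some path of `G` dominates `G`. The path has vertices `f 0, …, f n`; the values of `f`
beyond `n` are irrelevant, and so are the chords of the path. -/
def HasDominatingPath : Prop :=
  ∃ (n : ℕ) (f : ℕ → V), Set.InjOn f (Set.Iic n) ∧ (∀ i < n, G.Adj (f i) (f (i + 1))) ∧
    ∀ v, ∃ i ≤ n, v = f i ∨ G.Adj v (f i)

theorem hasDominatingPath_of_isPath {u v : V} (p : G.Walk u v) (hp : p.IsPath)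
    (hd : ∀ w, ∃ t ∈ p.support, w = t ∨ G.Adj w t) : HasDominatingPath G := by
  refine ⟨p.length, p.getVert, hp.getVert_injOn, fun i hi => p.adj_getVert_succ hi, fun w => ?_⟩
  obtain ⟨t, ht, h⟩ := hd w
  obtain ⟨i, rfl, hi⟩ := SimpleGraph.Walk.mem_support_iff_exists_getVert.1 ht
  exact ⟨i, hi, h⟩

/-- A stretch of a path whose edges alternate in colour is a proper path. -/
theorem exists_isProperPath_of_le {K : Type*} {γ : Sym2 V → K} {n : ℕ} {f : ℕ → V}
    (hf : Set.InjOn f (Set.Iic n)) (hadj : ∀ i < n, G.Adj (f i) (f (i + 1)))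
    (hγ : ∀ i, i + 1 < n → γ s(f (i + 1), f (i + 1 + 1)) ≠ γ s(f i, f (i + 1)))
    (k i : ℕ) (hk : i + k ≤ n) :
    ∃ p : G.Walk (f i) (f (i + k)), IsProperPath (fun e : G.edgeSet => γ e) p ∧
      (∀ x ∈ p.support, ∃ a, i ≤ a ∧ a ≤ n ∧ x = f a) ∧
      ∀ e ∈ p.edges, ∃ a, i ≤ a ∧ a < n ∧ e = s(f a, f (a + 1)) := by
  induction k generalizing i with
  | zero =>
    refine ⟨SimpleGraph.Walk.nil, IsProperPath.nil _ _, ?_, by simp⟩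
    intro x hx
    exact ⟨i, le_rfl, by omega, by simpa using hx⟩
  | succ k ih =>
    obtain ⟨p, hp, hs, he⟩ := ih (i + 1) (by omega)
    rw [show i + (k + 1) = i + 1 + k by omega]
    refine ⟨SimpleGraph.Walk.cons (hadj i (by omega)) p, hp.cons _ ?_ ?_, ?_, ?_⟩
    · intro hmem
      obtain ⟨a, h1, h2, h3⟩ := hs _ hmem
      have := hf (show i ≤ n by omega) h2 h3
      omega
    · intro e hep hmem
      obtain ⟨a, h1, h2, rfl⟩ := he e hep
      have ha : i + 1 = a := by
        rcases Sym2.mem_iff.1 hmem with h | h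
        · exact hf (show i + 1 ≤ n by omega) (show a ≤ n by omega) h
        · have := hf (show i + 1 ≤ n by omega) (show a + 1 ≤ n by omega) h
          omega
      subst ha
      exact hγ i h2
    · intro x hx
      rcases List.mem_cons.1 (by simpa using hx) with rfl | hx
      · exact ⟨i, le_rfl, by omega, rfl⟩
      · obtain ⟨a, h1, h2, h3⟩ := hs x hx
        exact ⟨a, by omega, h2, h3⟩
    · intro e hep
      rcases List.mem_cons.1 (by simpa using hep) with rfl | hep
      · exact ⟨i, le_rfl, by omega, rfl⟩
      · obtain ⟨a, h1, h2, h3⟩ := he e hep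
        exact ⟨a, by omega, h2, h3⟩

/-- A vertex outside `D` reaches `D` by an edge of colour `k`. -/
def HasExit (G : SimpleGraph V) (γ : Sym2 V → Fin 4) (D : Set V) (x : V) (k : Fin 4) : Prop :=
  ∃ d ∈ D, G.Adj x d ∧ γ s(x, d) = k

/-- A set `D` that is internally connected by proper paths in the colours `0` and `1` makes the
whole graph properly connected if each vertex outside `D` has an edge into `D` in one of the
colours `2`, `3`, and reaches `D` through the other one, if need be after one step in colour `0`
or `1` to another outside vertex. Two outside vertices are then joined by entering and leaving `D`
in different colours, which works even if the two feet in `D` coincide. -/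
theorem isProperPathColoring_of_exits {γ : Sym2 V → Fin 4} {D : Set V}
    (hD : ∀ d ∈ D, ∀ d' ∈ D, ∃ p : G.Walk d d', IsProperPath (fun e : G.edgeSet => γ e) p ∧
      (∀ x ∈ p.support, x ∈ D) ∧ ∀ e ∈ p.edges, γ e < 2)
    (hout : ∀ x ∉ D, ∃ a b : Fin 4, 2 ≤ a ∧ 2 ≤ b ∧ a ≠ b ∧ HasExit G γ D x a ∧
      (HasExit G γ D x b ∨ ∃ y ∉ D, G.Adj x y ∧ γ s(x, y) < 2 ∧ HasExit G γ D y b)) :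
    IsProperPathColoring (fun e : G.edgeSet => γ e) := by
  have half : ∀ x ∉ D, ∀ a : Fin 4, 2 ≤ a → HasExit G γ D x a → ∀ d ∈ D,
      ∃ p : G.Walk x d, IsProperPath (fun e : G.edgeSet => γ e) p ∧
        (∀ z ∈ p.support, z = x ∨ z ∈ D) ∧ ∀ e ∈ p.edges, γ e = a ∨ γ e < 2 := by
    rintro x hx a ha ⟨d', hd', hadj, hc⟩ d hd
    obtain ⟨p, hp, hs, he⟩ := hD d' hd' d hd
    refine ⟨SimpleGraph.Walk.cons hadj p, hp.cons _ (fun h => hx (hs _ h)) ?_, ?_, ?_⟩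
    · intro e hep _ h
      have := he e hep
      rw [h, hc] at this
      exact absurd this (not_lt.2 ha)
    · intro z hz
      rcases List.mem_cons.1 (by simpa using hz) with rfl | hz
      · exact Or.inl rfl
      · exact Or.inr (hs z hz)
    · intro e hep
      rcases List.mem_cons.1 (by simpa using hep) with rfl | hep
      · exact Or.inl hc
      · exact Or.inr (he e hep)
  have full : ∀ x ∉ D, ∀ y ∉ D, x ≠ y → ∀ a b : Fin 4, 2 ≤ a → 2 ≤ b → a ≠ b →
      HasExit G γ D x a → HasExit G γ D y b →
      ∃ p : G.Walk y x, IsProperPath (fun e : G.edgeSet => γ e) p ∧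
        (∀ z ∈ p.support, z = x ∨ z = y ∨ z ∈ D) ∧ ∀ e ∈ p.edges, y ∈ e → γ e = b := by
    rintro x hx y hy hxy a b ha hb hab hxa ⟨d, hd, hadj, hc⟩
    obtain ⟨p, hp, hs, he⟩ := half x hx a ha hxa d hd
    have hyp : y ∉ p.reverse.support := by
      intro h
      rcases hs y (by simpa using h) with h | h
      · exact hxy h.symm
      · exact hy h
    refine ⟨SimpleGraph.Walk.cons hadj p.reverse, hp.reverse.cons _ hyp ?_, ?_, ?_⟩
    · intro e hep _ h
      rw [hc] at h
      rcases he e (by simpa using hep) with h' | h'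
      · exact hab (h'.symm.trans h)
      · rw [h] at h'
        exact absurd h' (not_lt.2 hb)
    · intro z hz
      rcases List.mem_cons.1 (by simpa using hz) with rfl | hz
      · exact Or.inr (Or.inl rfl)
      · rcases hs z (by simpa using hz) with h | h
        · exact Or.inl h
        · exact Or.inr (Or.inr h)
    · intro e hep hye
      rw [SimpleGraph.Walk.edges_cons, List.mem_cons] at hep
      rcases hep with rfl | hep
      · exact hc
      · exact absurd (SimpleGraph.Walk.mem_support_of_mem_edges hep hye) hyp
  intro u v huv
  by_cases hu : u ∈ D
  · by_cases hv : v ∈ D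
    · obtain ⟨p, hp, -⟩ := hD u hu v hv
      exact ⟨p, hp⟩
    · obtain ⟨a, b, ha, hb, hab, hva, -⟩ := hout v hv
      obtain ⟨p, hp, -⟩ := half v hv a ha hva u hu
      exact ⟨p.reverse, hp.reverse⟩
  · obtain ⟨a, b, ha, hb, hab, hua, hub⟩ := hout u hu
    by_cases hv : v ∈ D
    · obtain ⟨p, hp, -⟩ := half u hu a ha hua v hv
      exact ⟨p, hp⟩
    · obtain ⟨a', b', ha', hb', hab', hva, -⟩ := hout v hv
      by_cases haa : a' = a
      · subst haa
        rcases hub with hub | ⟨y, hy, huy, hcy, hyb⟩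
        · obtain ⟨p, hp, -⟩ := full v hv u hu huv.symm a' b ha' hb hab hva hub
          exact ⟨p, hp⟩
        · by_cases hvy : v = y
          · subst hvy
            exact ⟨_, (IsProperPath.nil _ v).cons huy (by simpa using huv) (by simp)⟩
          · obtain ⟨p, hp, hs, he⟩ := full v hv y hy hvy a' b ha' hb hab hva hyb
            refine ⟨SimpleGraph.Walk.cons huy p, hp.cons _ ?_ ?_⟩
            · intro h
              rcases hs u h with h | h | h
              · exact huv h
              · exact huy.ne h
              · exact hu h
            · intro e hep hye h
              rw [he e hep hye] at h
              rw [← h] at hcy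
              exact absurd hcy (not_lt.2 hb)
      · obtain ⟨p, hp, -⟩ := full v hv u hu huv.symm a' a ha' ha haa hva hua
        exact ⟨p, hp⟩

/-- A maximal independent subset of `S` dominates `S`. -/
theorem exists_maximal_independent [Finite V] (G : SimpleGraph V) (S : Set V) :
    ∃ X ⊆ S, (∀ x ∈ X, ∀ y ∈ X, ¬ G.Adj x y) ∧ ∀ y ∈ S, y ∉ X → ∃ x ∈ X, G.Adj y x := by
  obtain ⟨X, hX⟩ := (Set.toFinite
    {X : Set V | X ⊆ S ∧ ∀ x ∈ X, ∀ y ∈ X, ¬ G.Adj x y}).exists_maximal ⟨∅, by simp⟩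
  refine ⟨X, hX.prop.1, hX.prop.2, fun y hy hyX => ?_⟩
  by_contra! hno
  refine hyX (hX.le_of_ge (y := insert y X) ⟨Set.insert_subset hy hX.prop.1, ?_⟩
    (Set.subset_insert _ _) (Set.mem_insert _ _))
  rintro a (rfl | ha) b (rfl | hb)
  · exact G.loopless.irrefl _
  · exact hno b hb
  · exact fun h => hno a ha h.symm
  · exact hX.prop.2 a ha b hb

open Classical in
theorem pc_le_four_of_hasDominatingPath [Fintype V] [DecidableRel G.Adj] (hδ : 2 ≤ G.minDegree)
    (h : HasDominatingPath G) : pc G ≤ 4 := by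
  obtain ⟨n, f, hf, hadj, hdom⟩ := h
  set D : Set V := f '' Set.Iic n with hDdef
  have hfoot : ∀ x ∉ D, ∃ d ∈ D, G.Adj x d := by
    intro x hx
    obtain ⟨i, hi, rfl | h⟩ := hdom x
    · exact absurd ⟨i, hi, rfl⟩ hx
    · exact ⟨f i, ⟨i, hi, rfl⟩, h⟩
  obtain ⟨X, hXD, hXind, hXmax⟩ := exists_maximal_independent G Dᶜ
  -- A second foot in `D` for the vertices that have no neighbour outside `D`.
  have halt : ∀ x, ∃ d, x ∉ D → (∀ y ∉ D, ¬ G.Adj x y) → d ∈ D ∧ G.Adj x d ∧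
      ∃ d' ∈ D, G.Adj x d' ∧ d' ≠ d := by
    intro x
    by_cases hx : x ∉ D ∧ ∀ y ∉ D, ¬ G.Adj x y
    · have h2 : 1 < (G.neighborFinset x).card := by
        rw [SimpleGraph.card_neighborFinset_eq_degree]
        exact lt_of_lt_of_le (by omega) (G.minDegree_le_degree x)
      obtain ⟨d, hd, d', hd', hne⟩ := Finset.one_lt_card.1 h2
      rw [SimpleGraph.mem_neighborFinset] at hd hd'
      have hin : ∀ z, G.Adj x z → z ∈ D := fun z hz => by
        by_contra hzD
        exact hx.2 z hzD hz
      exact ⟨d, fun _ _ => ⟨hin d hd, hd, d', hin d' hd', hd', hne.symm⟩⟩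
    · exact ⟨x, fun h1 h2 => absurd ⟨h1, h2⟩ hx⟩
  choose alt halt using halt
  -- `third x d`: the edge from the outside vertex `x` to `d ∈ D` gets colour `3` rather than `2`.
  let third : V → V → Prop := fun x d => x ∉ X ∨ ((∀ y ∉ D, ¬ G.Adj x y) ∧ d = alt x)
  let γ : Sym2 V → Fin 4 := fun e =>
    if ∃ x ∉ D, ∃ d ∈ D, e = s(x, d) ∧ third x d then 3
    else if ∃ x ∉ D, ∃ d ∈ D, e = s(x, d) then 2
    else if ∃ i < n, Even i ∧ e = s(f i, f (i + 1)) then 0 else 1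
  have hcross : ∀ x ∉ D, ∀ d ∈ D, γ s(x, d) = if third x d then 3 else 2 := by
    intro x hx d hd
    have h2 : ∃ x' ∉ D, ∃ d' ∈ D, s(x, d) = s(x', d') := ⟨x, hx, d, hd, rfl⟩
    have h3 : (∃ x' ∉ D, ∃ d' ∈ D, s(x, d) = s(x', d') ∧ third x' d') ↔ third x d := by
      constructor
      · rintro ⟨x', hx', d', hd', he, ht⟩
        rcases Sym2.eq_iff.1 he with ⟨rfl, rfl⟩ | ⟨rfl, rfl⟩
        · exact ht
        · exact absurd hd' hx
      · exact fun ht => ⟨x, hx, d, hd, rfl, ht⟩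
    simp only [γ, h3, if_pos h2]
  have hsame : ∀ x y, (x ∈ D ↔ y ∈ D) → γ s(x, y) =
      if ∃ i < n, Even i ∧ s(x, y) = s(f i, f (i + 1)) then 0 else 1 := by
    intro x y hxy
    have h2 : ¬ ∃ x' ∉ D, ∃ d' ∈ D, s(x, y) = s(x', d') := by
      rintro ⟨x', hx', d', hd', he⟩
      rcases Sym2.eq_iff.1 he with ⟨rfl, rfl⟩ | ⟨rfl, rfl⟩
      · exact hx' (hxy.2 hd')
      · exact hx' (hxy.1 hd')
    have h3 : ¬ ∃ x' ∉ D, ∃ d' ∈ D, s(x, y) = s(x', d') ∧ third x' d' := by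
      rintro ⟨x', hx', d', hd', he, -⟩
      exact h2 ⟨x', hx', d', hd', he⟩
    simp only [γ, if_neg h2, if_neg h3]
  have hlow : ∀ x y, (x ∈ D ↔ y ∈ D) → γ s(x, y) < 2 := by
    intro x y hxy
    rw [hsame x y hxy]
    split_ifs <;> decide
  have hmemD : ∀ i ≤ n, f i ∈ D := fun i hi => ⟨i, hi, rfl⟩
  have hpath : ∀ i < n, γ s(f i, f (i + 1)) = if Even i then 0 else 1 := by
    intro i hi
    rw [hsame _ _ (iff_of_true (hmemD _ hi.le) (hmemD _ hi))]
    congr 1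
    refine propext ⟨?_, fun h => ⟨i, hi, h, rfl⟩⟩
    rintro ⟨j, hj, hje, he⟩
    rcases Sym2.eq_iff.1 he with ⟨h1, h2⟩ | ⟨h1, h2⟩
    · rwa [hf (show i ≤ n by omega) (show j ≤ n by omega) h1]
    · have := hf (show i ≤ n by omega) (show j + 1 ≤ n by omega) h1
      have := hf (show i + 1 ≤ n by omega) (show j ≤ n by omega) h2
      omega
  have halternate : ∀ i, i + 1 < n → γ s(f (i + 1), f (i + 1 + 1)) ≠ γ s(f i, f (i + 1)) := by
    intro i hi
    rw [hpath _ hi, hpath i (by omega)]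
    by_cases hi' : Even i <;> simp [hi', Nat.even_add_one]
  refine Nat.sInf_le ⟨fun e => γ e, isProperPathColoring_of_exits (D := D) ?_ ?_⟩
  · have key : ∀ i j, i ≤ j → j ≤ n → ∃ p : G.Walk (f i) (f j),
        IsProperPath (fun e : G.edgeSet => γ e) p ∧
          (∀ x ∈ p.support, x ∈ D) ∧ ∀ e ∈ p.edges, γ e < 2 := by
      intro i j hij hj
      obtain ⟨k, rfl⟩ := Nat.exists_eq_add_of_le hij
      obtain ⟨p, hp, hs, he⟩ := exists_isProperPath_of_le hf hadj halternate k i hj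
      refine ⟨p, hp, fun x hx => ?_, fun e hep => ?_⟩
      · obtain ⟨a, -, ha, rfl⟩ := hs x hx
        exact hmemD a ha
      · obtain ⟨a, -, ha, rfl⟩ := he e hep
        exact hlow _ _ (iff_of_true (hmemD _ ha.le) (hmemD _ ha))
    rintro _ ⟨i, hi, rfl⟩ _ ⟨j, hj, rfl⟩
    rcases le_total i j with hij | hij
    · exact key i j hij hj
    · obtain ⟨p, hp, hs, he⟩ := key j i hij hi
      exact ⟨p.reverse, hp.reverse, fun x hx => hs x (by simpa using hx),
        fun e hep => he e (by simpa using hep)⟩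
  · have exitY : ∀ y ∉ D, y ∉ X → HasExit G γ D y 3 := by
      intro y hy hyX
      obtain ⟨d, hd, h⟩ := hfoot y hy
      exact ⟨d, hd, h, by rw [hcross y hy d hd, if_pos (Or.inl hyX)]⟩
    intro x hx
    by_cases hiso : ∀ y ∉ D, ¬ G.Adj x y
    · obtain ⟨hd, hxd, d', hd', hxd', hne⟩ := halt x hx hiso
      have hxX : x ∈ X := by
        by_contra hxX
        obtain ⟨y, hy, h⟩ := hXmax x hx hxX
        exact hiso y (hXD hy) h
      refine ⟨2, 3, by decide, by decide, by decide, ⟨d', hd', hxd', ?_⟩,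
        Or.inl ⟨alt x, hd, hxd, ?_⟩⟩
      · rw [hcross x hx d' hd', if_neg]
        rintro (h | ⟨-, h⟩)
        · exact h hxX
        · exact hne h
      · rw [hcross x hx _ hd, if_pos (Or.inr ⟨hiso, rfl⟩)]
    · have exitX : ∀ x ∉ D, x ∈ X → (¬ ∀ y ∉ D, ¬ G.Adj x y) → HasExit G γ D x 2 := by
        intro x hx hxX hiso
        obtain ⟨d, hd, h⟩ := hfoot x hx
        refine ⟨d, hd, h, ?_⟩
        rw [hcross x hx d hd, if_neg]
        rintro (h | ⟨h, -⟩)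
        · exact h hxX
        · exact hiso h
      by_cases hxX : x ∈ X
      · have := hiso
        push Not at this
        obtain ⟨y, hy, hxy⟩ := this
        exact ⟨2, 3, by decide, by decide, by decide, exitX x hx hxX hiso, Or.inr
          ⟨y, hy, hxy, hlow _ _ (iff_of_false hx hy),
            exitY y hy fun hyX => hXind x hxX y hyX hxy⟩⟩
      · obtain ⟨y, hyX, hxy⟩ := hXmax x hx hxX
        have hy : y ∉ D := hXD hyX
        exact ⟨3, 2, by decide, by decide, by decide, exitY x hx hxX, Or.inr
          ⟨y, hy, hxy, hlow _ _ (iff_of_false hx hy),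
            exitX y hy hyX fun h => h x hx hxy.symm⟩⟩

/-! ### Dominating paths in AT-free graphs -/

variable (G) in
/-- `a` and `b` lie in the same component of `G` minus the closed neighbourhood of `y`;
in particular neither of them is in that closed neighbourhood. -/
def JoinedOff (y a b : V) : Prop :=
  ∃ p : G.Walk a b, ∀ t ∈ p.support, t ≠ y ∧ ¬ G.Adj y t

namespace JoinedOff

variable {y a b c w : V}

theorem left (h : JoinedOff G y a b) : a ≠ y ∧ ¬ G.Adj y a :=
  let ⟨p, hp⟩ := h
  hp a p.start_mem_support

theorem right (h : JoinedOff G y a b) : b ≠ y ∧ ¬ G.Adj y b :=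
  let ⟨p, hp⟩ := h
  hp b p.end_mem_support

theorem symm (h : JoinedOff G y a b) : JoinedOff G y b a :=
  let ⟨p, hp⟩ := h
  ⟨p.reverse, fun t ht => hp t (by simpa using ht)⟩

theorem trans (h : JoinedOff G y a b) (h' : JoinedOff G y b c) : JoinedOff G y a c := by
  obtain ⟨p, hp⟩ := h
  obtain ⟨q, hq⟩ := h'
  refine ⟨p.append q, fun t ht => ?_⟩
  rcases (SimpleGraph.Walk.mem_support_append_iff p q).1 ht with h | h
  · exact hp t h
  · exact hq t h

theorem of_adj (ha : a ≠ y ∧ ¬ G.Adj y a) (hb : b ≠ y ∧ ¬ G.Adj y b) (h : G.Adj a b) :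
    JoinedOff G y a b := by
  refine ⟨h.toWalk, fun t ht => ?_⟩
  have : t = a ∨ t = b := by simpa using ht
  rcases this with rfl | rfl
  · exact ha
  · exact hb

/-- A component of `G - N[y]` that does not contain `w ∉ N[y]` has no vertex in `N[w]`, so it
stays connected in `G - N[w]`. -/
theorem of_not_joinedOff (hw : w ≠ y ∧ ¬ G.Adj y w) (haw : ¬ JoinedOff G y a w)
    (h : JoinedOff G y a b) : JoinedOff G w a b := by
  classical
  obtain ⟨p, hp⟩ := h
  refine ⟨p, fun t ht => ?_⟩
  have hat : JoinedOff G y a t :=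
    ⟨p.takeUntil t ht, fun s hs => hp s (p.support_takeUntil_subset_support ht hs)⟩
  exact ⟨fun h => haw (h ▸ hat), fun h => haw (hat.trans (of_adj (hp t ht) hw h.symm))⟩

theorem pathAvoidingNeighbors (h : JoinedOff G y a b) : PathAvoidingNeighbors G a b y := by
  classical
  obtain ⟨p, hp⟩ := h
  exact ⟨p.bypass, p.bypass_isPath, fun t ht => (hp t (p.support_bypass_subset_support ht)).2⟩

end JoinedOff

/-- In an AT-free graph, if `y` reaches `v` off `N[w]` and `w` off `N[v]`, then `N[y]` separates
`v` from `w`. -/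
theorem IsATFree.not_joinedOff (hG : IsATFree G) {y v w : V} (hv : JoinedOff G w y v)
    (hw : JoinedOff G v y w) : ¬ JoinedOff G y v w := fun h =>
  hG y v w ⟨hw.left.1, hv.right.1, hv.left.1, fun e => hw.left.2 e.symm, fun e => hv.right.2 e.symm,
    fun e => hv.left.2 e.symm, hv.pathAvoidingNeighbors, h.pathAvoidingNeighbors,
    hw.pathAvoidingNeighbors⟩

open Classical in
/-- The weight `∑ z, 2 ^ |C z|`, where `C z` is the component of `z` in `G - N[y]`, empty if `z` is
in `N[y]`. The exponential makes enlarging a component of size `b` worth more than losing another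
one of size at most `b`. -/
noncomputable def componentWeight [Fintype V] (G : SimpleGraph V) (y : V) : ℕ :=
  ∑ z, 2 ^ (Finset.univ.filter fun b => JoinedOff G y z b).card

open Classical in
/-- Passing from `y` to `v` destroys only the component of `v` in `G - N[y]`; the component of `w`,
at least as large, absorbs `y`. -/
theorem componentWeight_lt [Fintype V] {y v w : V} (hv : JoinedOff G w y v)
    (hw : JoinedOff G v y w) (hvw : ¬ JoinedOff G y v w)
    (hcard : (Finset.univ.filter fun b => JoinedOff G y v b).card ≤
      (Finset.univ.filter fun b => JoinedOff G y w b).card) :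
    componentWeight G y < componentWeight G v := by
  set C : V → V → Finset V := fun y z => Finset.univ.filter fun b => JoinedOff G y z b with hC
  have hmem : ∀ y z b, b ∈ C y z ↔ JoinedOff G y z b := by simp [hC]
  have hyv : v ≠ y ∧ ¬ G.Adj y v := ⟨hw.left.1.symm, fun e => hw.left.2 e.symm⟩
  have hyw : w ≠ y ∧ ¬ G.Adj y w := ⟨hv.left.1.symm, fun e => hv.left.2 e.symm⟩
  have hclass : ∀ a z, z ∈ C y a → C y z = C y a := by
    intro a z hz
    rw [hmem] at hz
    ext b
    rw [hmem, hmem]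
    exact ⟨hz.trans, hz.symm.trans⟩
  have hyy : C y y = ∅ := by
    ext b
    simp only [hmem, Finset.notMem_empty, iff_false]
    exact fun h => h.left.1 rfl
  have hyA : y ∉ C y v := fun h => ((hmem _ _ _).1 h).right.1 rfl
  have hyB : y ∉ C y w := fun h => ((hmem _ _ _).1 h).right.1 rfl
  have hAB : C y w ⊆ (C y v)ᶜ := by
    intro z hz
    rw [Finset.mem_compl, hmem]
    rw [hmem] at hz
    exact fun h => hvw (h.trans hz.symm)
  have hmono : ∀ z ∈ (C y v)ᶜ, C y z ⊆ C v z := by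
    intro z hz b hb
    rw [Finset.mem_compl, hmem] at hz
    rw [hmem] at hb ⊢
    exact JoinedOff.of_not_joinedOff hyv (fun h => hz h.symm) hb
  -- Every vertex of the component of `w`, and `y` itself, now sees that component and `y`.
  have hgrow : ∀ z, JoinedOff G v z w → 2 * 2 ^ (C y w).card ≤ 2 ^ (C v z).card := by
    intro z hz
    rw [← pow_succ']
    refine Nat.pow_le_pow_right (by norm_num) ?_
    rw [← Finset.card_insert_of_notMem hyB]
    refine Finset.card_le_card (Finset.insert_subset ?_ fun b hb => ?_)
    · exact (hmem _ _ _).2 (hz.trans hw.symm)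
    · rw [hmem] at hb ⊢
      exact hz.trans (JoinedOff.of_not_joinedOff hyv (fun h => hvw h.symm) hb)
  have hA : ∑ z ∈ C y v, 2 ^ (C y z).card ≤ ∑ z ∈ C y w, 2 ^ (C y z).card := by
    have hsum : ∀ a, ∑ z ∈ C y a, 2 ^ (C y z).card = (C y a).card * 2 ^ (C y a).card := by
      intro a
      rw [Finset.sum_congr rfl fun z hz => congrArg (fun s : Finset V => 2 ^ s.card)
        (hclass a z hz), Finset.sum_const, smul_eq_mul]
    rw [hsum, hsum]
    exact Nat.mul_le_mul hcard (Nat.pow_le_pow_right (by norm_num) hcard)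
  have hrest : ∑ z ∈ (C y v)ᶜ, 2 ^ (C y z).card + ∑ z ∈ C y w, 2 ^ (C y z).card + 1 ≤
      ∑ z ∈ (C y v)ᶜ, 2 ^ (C v z).card := by
    have h1 : ∑ z ∈ C y w, 2 ^ (C y z).card =
        ∑ z ∈ (C y v)ᶜ, if z ∈ C y w then 2 ^ (C y z).card else 0 := by
      rw [← Finset.sum_filter, Finset.filter_mem_eq_inter, Finset.inter_eq_right.2 hAB]
    have h2 : 1 = ∑ z ∈ (C y v)ᶜ, if z = y then 1 else 0 := by
      rw [Finset.sum_ite_eq' _ y, if_pos (Finset.mem_compl.2 hyA)]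
    refine (congrArg₂ (· + ·) (congrArg _ h1) h2).trans_le ?_
    rw [← Finset.sum_add_distrib, ← Finset.sum_add_distrib]
    refine Finset.sum_le_sum fun z hz => ?_
    by_cases hzB : z ∈ C y w
    · have hzy : z ≠ y := fun h => hyB (h ▸ hzB)
      have := hgrow z (JoinedOff.of_not_joinedOff hyv (fun h => hvw h.symm)
        ((hmem _ _ _).1 hzB)).symm
      rw [if_pos hzB, if_neg hzy, hclass w z hzB]
      omega
    · rw [if_neg hzB]
      by_cases hzy : z = y
      · subst hzy
        have := hgrow z hw
        have h1 : 1 ≤ 2 ^ (C z w).card := Nat.one_le_two_pow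
        rw [if_pos rfl, hyy, Finset.card_empty]
        omega
      · rw [if_neg hzy]
        simpa using Nat.pow_le_pow_right (n := 2) (by norm_num) (Finset.card_le_card (hmono z hz))
  have hvpos := Finset.sum_add_sum_compl (C y v) fun z => 2 ^ (C v z).card
  have hypos := Finset.sum_add_sum_compl (C y v) fun z => 2 ^ (C y z).card
  change ∑ z, 2 ^ (C y z).card < ∑ z, 2 ^ (C v z).card
  omega

/-- An AT-free graph has a vertex `u` that is admissible: no two vertices are each reachable from
`u` off the closed neighbourhood of the other. -/
theorem IsATFree.exists_admissible [Finite V] [Nonempty V] (hG : IsATFree G) :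
    ∃ u, ∀ v w, JoinedOff G w u v → ¬ JoinedOff G v u w := by
  classical
  have := Fintype.ofFinite V
  obtain ⟨u, hu⟩ := Finite.exists_max (componentWeight G)
  refine ⟨u, fun v w hv hw => ?_⟩
  have hvw := hG.not_joinedOff hv hw
  rcases le_total (Finset.univ.filter fun b => JoinedOff G u v b).card
    (Finset.univ.filter fun b => JoinedOff G u w b).card with h | h
  · exact (componentWeight_lt hv hw hvw h).not_ge (hu v)
  · exact (componentWeight_lt hw hv (fun h => hvw h.symm) h).not_ge (hu w)

/-- From an admissible `u`, choose `v` such that the component of `u` in `G - N[v]` is as large as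
possible. If a path from `u` to `v` missed `N[w]`, then `N[v]` would separate `u` from `w`, and
`w` would leave a larger component. -/
theorem IsATFree.hasDominatingPath [Finite V] (hconn : G.Connected) (hG : IsATFree G) :
    HasDominatingPath G := by
  classical
  have := hconn.nonempty
  obtain ⟨u, hu⟩ := hG.exists_admissible
  by_cases huniv : ∀ v, v = u ∨ G.Adj v u
  · exact hasDominatingPath_of_isPath (SimpleGraph.Walk.nil : G.Walk u u)
      SimpleGraph.Walk.IsPath.nil fun w => ⟨u, by simp, huniv w⟩
  push Not at huniv
  obtain ⟨v₀, hv₀⟩ := huniv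
  obtain ⟨v, hv, hmax⟩ := (Set.toFinite {v | v ≠ u ∧ ¬ G.Adj v u}).exists_maximalFor
    (fun v => {b | JoinedOff G v u b}.ncard) _ ⟨v₀, hv₀⟩
  obtain ⟨p, hp⟩ := hconn.exists_isPath u v
  refine hasDominatingPath_of_isPath p hp fun w => ?_
  by_contra! hw
  have hpw : JoinedOff G w u v := ⟨p, fun t ht => ⟨(hw t ht).1.symm, (hw t ht).2⟩⟩
  have hlt : {b | JoinedOff G v u b}.ncard < {b | JoinedOff G w u b}.ncard := by
    refine Set.ncard_lt_ncard ⟨fun b hb => ?_, fun h => ?_⟩ (Set.toFinite _)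
    · exact JoinedOff.of_not_joinedOff ⟨hpw.right.1.symm, fun h => hpw.right.2 h.symm⟩
        (hu v w hpw) hb
    · exact (JoinedOff.right (h (show JoinedOff G w u v from hpw))).1 rfl
  exact hlt.not_ge (hmax (j := w) ⟨hpw.left.1.symm, hpw.left.2⟩ hlt.le)

/-! ### Interval graphs are AT-free -/

theorem lt_of_disjoint_of_lt {I J : Set ℝ} (hI : I.OrdConnected) (hJ : J.OrdConnected)
    (hIJ : ¬ (I ∩ J).Nonempty) {a b : ℝ} (ha : a ∈ I) (hb : b ∈ J) (hab : a < b) :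
    ∀ x ∈ I, ∀ y ∈ J, x < y := by
  intro x hx y hy
  by_contra! h
  have hyI : ¬ a ≤ y := fun h' => hIJ ⟨y, hI.out ha hx ⟨h', h⟩, hy⟩
  exact hIJ ⟨a, ha, hJ.out hy hb ⟨(not_le.1 hyI).le, hab.le⟩⟩

/-- A walk that starts to the left of the interval of `z` and avoids the neighbours of `z` stays to
its left. -/
theorem left_of_walk {S : V → Set ℝ} (hS : ∀ v, IsRealInterval (S v))
    (hGS : IsIntersectionGraphOf G S) {x y z : V} (p : G.Walk x y)
    (hp : ∀ t ∈ p.support, ¬ G.Adj z t) (hx : ∀ a ∈ S x, ∀ b ∈ S z, a < b) :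
    ∀ a ∈ S y, ∀ b ∈ S z, a < b := by
  induction p with
  | nil => exact hx
  | @cons x t y h p ih =>
    refine ih (fun s hs => hp s (by simp [hs])) ?_
    have hzx : ¬ G.Adj z x := hp x (by simp)
    have hzt : ¬ G.Adj z t := hp t (by simp)
    have htz : t ≠ z := by
      rintro rfl
      exact hzx h.symm
    obtain ⟨a, hax, hat⟩ := (hGS x t h.ne).1 h
    obtain ⟨b, hb⟩ := (hS z).1
    exact lt_of_disjoint_of_lt (hS t).2 (hS z).2
      (fun hne => hzt ((hGS t z htz).2 hne).symm) hat hb (hx a hax b hb)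

theorem IsIntervalGraph.isATFree (hG : IsIntervalGraph G) : IsATFree G := by
  obtain ⟨S, hS, hGS⟩ := hG
  -- Of three disjoint intervals `I < J < K`, the middle one blocks every walk from `I` to `K`.
  have block : ∀ x y z, x ≠ z → y ≠ z → ¬ G.Adj x z → ¬ G.Adj y z →
      PathAvoidingNeighbors G x y z → ∀ a ∈ S x, ∀ b ∈ S y, ∀ c ∈ S z, ¬ (a < c ∧ c < b) := by
    rintro x y z hxz hyz hnxz hnyz ⟨p, -, hp⟩ a ha b hb c hc ⟨hac, hcb⟩
    have h := left_of_walk hS hGS p hp (lt_of_disjoint_of_lt (hS x).2 (hS z).2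
      (fun hne => hnxz ((hGS x z hxz).2 hne)) ha hc hac) b hb c hc
    exact h.not_gt hcb
  have rev : ∀ x y z, PathAvoidingNeighbors G x y z → PathAvoidingNeighbors G y x z :=
    fun x y z ⟨p, hp, h⟩ => ⟨p.reverse, hp.reverse, fun t ht => h t (by simpa using ht)⟩
  rintro x y z ⟨hxy, hyz, hxz, nxy, nyz, nxz, pz, px, py⟩
  obtain ⟨a, ha⟩ := (hS x).1
  obtain ⟨b, hb⟩ := (hS y).1
  obtain ⟨c, hc⟩ := (hS z).1
  have hdisj : ∀ u v, u ≠ v → ¬ G.Adj u v → ∀ r ∈ S u, ∀ s ∈ S v, r ≠ s := by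
    rintro u v huv hn r hr s hs rfl
    exact hn ((hGS u v huv).2 ⟨r, hr, hs⟩)
  have hab := hdisj x y hxy nxy a ha b hb
  have hbc := hdisj y z hyz nyz b hb c hc
  have hac := hdisj x z hxz nxz a ha c hc
  have nyx : ¬ G.Adj y x := fun h => nxy h.symm
  have nzx : ¬ G.Adj z x := fun h => nxz h.symm
  have nzy : ¬ G.Adj z y := fun h => nyz h.symm
  have h1 := block x y z hxz hyz nxz nyz pz a ha b hb c hc
  have h2 := block y x z hyz hxz nyz nxz (rev _ _ _ pz) b hb a ha c hc
  have h3 := block y z x hxy.symm hxz.symm nyx nzx px b hb c hc a ha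
  have h4 := block z y x hxz.symm hxy.symm nzx nyx (rev _ _ _ px) c hc b hb a ha
  have h5 := block x z y hxy hyz.symm nxy nzy py a ha c hc b hb
  have h6 := block z x y hyz.symm hxy nzy nxy (rev _ _ _ py) c hc a ha b hb
  grind

/-! ### Circular arc graphs -/

/-- The translate by `2πk` of the interval `I v`, one of the lifts to the line of the arc
`Circle.exp '' I v`. -/
def liftedInterval (I : V → Set ℝ) (x : V × ℤ) : Set ℝ :=
  {r | r - x.2 * (2 * Real.pi) ∈ I x.1}

/-- The intersection graph of all lifts of a family of arcs. It covers the intersection graph of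
the arcs, except that two lifts of an arc of length at least `2π` may be adjacent. -/
def liftGraph (I : V → Set ℝ) : SimpleGraph (V × ℤ) where
  Adj x y := x ≠ y ∧ (liftedInterval I x ∩ liftedInterval I y).Nonempty
  symm := ⟨fun _ _ h => ⟨h.1.symm, by rw [Set.inter_comm]; exact h.2⟩⟩
  loopless := ⟨fun _ h => h.1 rfl⟩

theorem liftedInterval_ordConnected {I : V → Set ℝ} (hI : ∀ v, (I v).OrdConnected) (x : V × ℤ) :
    (liftedInterval I x).OrdConnected := by
  refine ⟨fun a ha b hb r hr => (hI x.1).out ha hb ⟨?_, ?_⟩⟩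
  · linarith [hr.1]
  · linarith [hr.2]

theorem exp_mem_of_mem_liftedInterval {I : V → Set ℝ} {x : V × ℤ} {r : ℝ}
    (h : r ∈ liftedInterval I x) : Circle.exp r ∈ Circle.exp '' I x.1 :=
  ⟨_, h, Circle.exp_eq_exp.2 ⟨-x.2, by push_cast; ring⟩⟩

theorem exists_mem_liftedInterval {I : V → Set ℝ} {v : V} {r : ℝ}
    (h : Circle.exp r ∈ Circle.exp '' I v) : ∃ k : ℤ, r ∈ liftedInterval I (v, k) := by
  obtain ⟨s, hs, he⟩ := h
  obtain ⟨m, rfl⟩ := Circle.exp_eq_exp.1 he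
  refine ⟨-m, ?_⟩
  have : r - ((-m : ℤ) : ℝ) * (2 * Real.pi) = r + m * (2 * Real.pi) := by push_cast; ring
  change r - ((-m : ℤ) : ℝ) * (2 * Real.pi) ∈ I v
  rwa [this]

/-- The lifts along a walk leave no gap. -/
theorem exists_mem_support_of_mem_Icc {I : V → Set ℝ} (hI : ∀ v, (I v).OrdConnected)
    {x y : V × ℤ} (p : (liftGraph I).Walk x y) {a b r : ℝ} (ha : a ∈ liftedInterval I x)
    (hb : b ∈ liftedInterval I y) (hr : r ∈ Set.Icc a b) :
    ∃ t ∈ p.support, r ∈ liftedInterval I t := by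
  induction p generalizing a with
  | nil => exact ⟨_, by simp, (liftedInterval_ordConnected hI _).out ha hb hr⟩
  | @cons x t y h p ih =>
    obtain ⟨c, hcx, hct⟩ := h.2
    rcases le_total r c with hrc | hrc
    · exact ⟨x, by simp, (liftedInterval_ordConnected hI _).out ha hcx ⟨hr.1, hrc⟩⟩
    · obtain ⟨s, hs, hrs⟩ := ih hct hb ⟨hrc, hr.2⟩
      exact ⟨s, by simp [hs], hrs⟩

/-- A walk in the lift that joins two lifts of one arc winds around the circle, so its arcs cover
the circle. If it is as short as possible, then it projects to a dominating path. -/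
theorem hasDominatingPath_of_lift {I : V → Set ℝ} (hI : ∀ v, IsRealInterval (I v))
    (hG : IsIntersectionGraphOf G fun v => Circle.exp '' I v)
    (h : ∃ x y, (liftGraph I).Reachable x y ∧ x ≠ y ∧ x.1 = y.1) : HasDominatingPath G := by
  classical
  have hex : ∃ n, ∃ x y, ∃ p : (liftGraph I).Walk x y, x ≠ y ∧ x.1 = y.1 ∧ p.length = n := by
    obtain ⟨x, y, ⟨p⟩, hne, he⟩ := h
    exact ⟨_, x, y, p, hne, he, rfl⟩
  have hmin := fun m => Nat.find_min (m := m) hex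
  obtain ⟨x, y, p, hne, he, hlen⟩ := Nat.find_spec hex
  rw [← hlen] at hmin
  have hpos : 0 < p.length := by
    rw [Nat.pos_iff_ne_zero]
    exact fun h => hne (SimpleGraph.Walk.eq_of_length_eq_zero h)
  have hlt : ∀ i j, i < j → j ≤ p.length - 1 → (p.getVert i).1 ≠ (p.getVert j).1 := by
    intro i j hij hj heq
    by_cases hg : p.getVert i = p.getVert j
    · refine hmin (i + (p.length - j)) (by omega)
        ⟨x, y, (p.take i).append ((p.drop j).copy hg.symm rfl), hne, he, ?_⟩
      rw [SimpleGraph.Walk.length_append, SimpleGraph.Walk.length_copy,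
        SimpleGraph.Walk.take_length, SimpleGraph.Walk.drop_length]
      omega
    · have hend : (p.drop i).getVert (j - i) = p.getVert j := by
        rw [SimpleGraph.Walk.drop_getVert]
        congr 1
        omega
      refine hmin (j - i) (by omega) ⟨_, _, ((p.drop i).take (j - i)).copy rfl hend, hg, heq, ?_⟩
      rw [SimpleGraph.Walk.length_copy, SimpleGraph.Walk.take_length,
        SimpleGraph.Walk.drop_length]
      omega
  have hadj : ∀ s t, (liftGraph I).Adj s t → s.1 ≠ t.1 → G.Adj s.1 t.1 := by
    rintro s t ⟨-, r, hs, ht⟩ hst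
    exact (hG _ _ hst).2
      ⟨_, exp_mem_of_mem_liftedInterval hs, exp_mem_of_mem_liftedInterval ht⟩
  refine ⟨p.length - 1, fun i => (p.getVert i).1, ?_, ?_, fun v => ?_⟩
  · intro i hi j hj hij
    rcases lt_trichotomy i j with h | h | h
    · exact absurd hij (hlt i j h hj)
    · exact h
    · exact absurd hij.symm (hlt j i h hi)
  · intro i hi
    exact hadj _ _ (p.adj_getVert_succ (by omega)) (hlt i (i + 1) (by omega) (by omega))
  · obtain ⟨s, hs⟩ := (hI v).1
    obtain ⟨a, ha⟩ := (hI x.1).1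
    -- Between two lifts of `a` lies a full turn, which contains a lift of `s`.
    have cover : ∀ k l : ℤ, k < l → ∃ m : ℤ, s + m * (2 * Real.pi) ∈
        Set.Icc (a + k * (2 * Real.pi)) (a + l * (2 * Real.pi)) := by
      intro k l hkl
      obtain ⟨m, hm, -⟩ :=
        existsUnique_add_zsmul_mem_Ico Real.two_pi_pos s (a + k * (2 * Real.pi))
      rw [zsmul_eq_mul] at hm
      refine ⟨m, hm.1, hm.2.le.trans ?_⟩
      have : (k : ℝ) + 1 ≤ l := by exact_mod_cast hkl
      nlinarith [Real.two_pi_pos]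
    have hlift : ∀ z : V × ℤ, z.1 = x.1 → a + z.2 * (2 * Real.pi) ∈ liftedInterval I z := by
      intro z hz
      simpa [liftedInterval, hz] using ha
    have hmeet : ∃ t ∈ p.support, ∃ m : ℤ, s + m * (2 * Real.pi) ∈ liftedInterval I t := by
      have h2 : x.2 ≠ y.2 := fun h => hne (Prod.ext he h)
      rcases lt_or_gt_of_ne h2 with h | h
      · obtain ⟨m, hm⟩ := cover _ _ h
        obtain ⟨t, ht, hr⟩ := exists_mem_support_of_mem_Icc (fun v => (hI v).2) p
          (hlift x rfl) (hlift y he.symm) hm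
        exact ⟨t, ht, m, hr⟩
      · obtain ⟨m, hm⟩ := cover _ _ h
        obtain ⟨t, ht, hr⟩ := exists_mem_support_of_mem_Icc (fun v => (hI v).2) p.reverse
          (hlift y he.symm) (hlift x rfl) hm
        exact ⟨t, by simpa using ht, m, hr⟩
    obtain ⟨t, ht, m, hr⟩ := hmeet
    have hvt : v = t.1 ∨ G.Adj v t.1 := by
      by_cases hvt : v = t.1
      · exact Or.inl hvt
      · refine Or.inr ((hG v t.1 hvt).2 ⟨_, ⟨s, hs, ?_⟩, exp_mem_of_mem_liftedInterval hr⟩)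
        exact (Circle.exp_eq_exp.2 ⟨m, rfl⟩).symm
    obtain ⟨i, rfl, hi⟩ := SimpleGraph.Walk.mem_support_iff_exists_getVert.1 ht
    by_cases hin : i = p.length
    · -- The last vertex of the walk projects to the same vertex as the first one.
      refine ⟨0, by omega, ?_⟩
      rw [hin, SimpleGraph.Walk.getVert_length, ← he] at hvt
      simpa using hvt
    · exact ⟨i, by omega, hvt⟩

/-- If no two lifts of one arc are connected, a component of the lift projects isomorphically onto
the connected graph `G`, which is therefore an interval graph. -/
theorem isIntervalGraph_of_lift (hconn : G.Connected) {I : V → Set ℝ}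
    (hI : ∀ v, IsRealInterval (I v)) (hG : IsIntersectionGraphOf G fun v => Circle.exp '' I v)
    (h : ∀ x y, (liftGraph I).Reachable x y → x.1 = y.1 → x = y) : IsIntervalGraph G := by
  obtain ⟨v₀⟩ := hconn.nonempty
  have hstep : ∀ x : V × ℤ, ∀ w, G.Adj x.1 w → ∃ l : ℤ, (liftGraph I).Adj x (w, l) := by
    intro x w hxw
    obtain ⟨_, ⟨a, ha, rfl⟩, hw⟩ := (hG _ _ hxw.ne).1 hxw
    have hshift : Circle.exp (a + x.2 * (2 * Real.pi)) = Circle.exp a :=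
      Circle.exp_eq_exp.2 ⟨x.2, rfl⟩
    obtain ⟨l, hl⟩ := exists_mem_liftedInterval (hshift ▸ hw)
    refine ⟨l, fun e => hxw.ne (congrArg Prod.fst e), _, ?_, hl⟩
    simpa [liftedInterval] using ha
  have hlift : ∀ {u v} (p : G.Walk u v) (k : ℤ), ∃ l : ℤ, (liftGraph I).Reachable (u, k) (v, l) := by
    intro u v p
    induction p with
    | nil => exact fun k => ⟨k, SimpleGraph.Reachable.refl _⟩
    | cons hadj p ih =>
      intro k
      obtain ⟨m, hm⟩ := hstep (_, k) _ hadj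
      obtain ⟨l, hl⟩ := ih m
      exact ⟨l, hm.reachable.trans hl⟩
  have hk : ∀ v, ∃ k : ℤ, (liftGraph I).Reachable (v₀, 0) (v, k) := fun v =>
    let ⟨p⟩ := hconn.preconnected v₀ v
    hlift p 0
  choose k hk using hk
  refine ⟨fun v => liftedInterval I (v, k v), fun v => ⟨?_, liftedInterval_ordConnected
    (fun v => (hI v).2) _⟩, fun u v huv => ⟨fun hadj => ?_, ?_⟩⟩
  · obtain ⟨a, ha⟩ := (hI v).1
    exact ⟨a + k v * (2 * Real.pi), by simpa [liftedInterval] using ha⟩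
  · obtain ⟨l, hl⟩ := hstep (u, k u) v hadj
    have := h (v, k v) (v, l) ((hk v).symm.trans ((hk u).trans hl.reachable)) rfl
    rw [← this] at hl
    exact hl.2
  · rintro ⟨r, hu, hv⟩
    exact (hG u v huv).2 ⟨_, exp_mem_of_mem_liftedInterval hu, exp_mem_of_mem_liftedInterval hv⟩

theorem IsCircularArcGraph.hasDominatingPath [Finite V] (hconn : G.Connected)
    (hG : IsCircularArcGraph G) : HasDominatingPath G := by
  obtain ⟨S, hS, hGS⟩ := hG
  choose I hI hSI using hS
  obtain rfl : S = fun v => Circle.exp '' I v := funext hSI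
  by_cases h : ∃ x y, (liftGraph I).Reachable x y ∧ x ≠ y ∧ x.1 = y.1
  · exact hasDominatingPath_of_lift hI hGS h
  · refine (isIntervalGraph_of_lift hconn hI hGS fun x y hr he => ?_).isATFree.hasDominatingPath
      hconn
    by_contra hne
    exact h ⟨x, y, hr, hne, he⟩

/-! ### Threshold graphs -/

theorem two_le_pc [Finite V] (hconn : G.Connected) (hnc : G ≠ ⊤) : 2 ≤ pc G := by
  obtain ⟨u, v, huv, hn⟩ : ∃ u v, u ≠ v ∧ ¬ G.Adj u v := by
    by_contra! h
    exact hnc (SimpleGraph.ext (funext fun u => funext fun v => propext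
      ⟨fun e => e.ne, fun e => h u v e⟩))
  obtain ⟨c, hc⟩ : ∃ c : G.edgeSet → Fin (pc G), IsProperPathColoring c :=
    Nat.sInf_mem (exists_isProperPathColoring G hconn)
  by_contra! hlt
  obtain ⟨p, hp, hcol⟩ := hc u v huv
  cases p with
  | nil => exact huv rfl
  | @cons _ a _ h p =>
    cases p with
    | nil => exact hn h
    | @cons _ b _ h' p =>
      have hub : u ≠ b := by
        rintro rfl
        simp [SimpleGraph.Walk.cons_isPath_iff] at hp
      refine hcol ⟨s(u, a), h⟩ ⟨s(a, b), h'⟩ (by simp) (by simp) ?_ ⟨a, by simp, by simp⟩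
        (Fin.ext (by omega))
      intro e
      have := congrArg Subtype.val e
      rcases Sym2.eq_iff.1 this with ⟨h1, -⟩ | ⟨h1, -⟩
      · exact h.ne h1
      · exact hub h1

/-- Colour the edge between the two universal vertices `a`, `b` by `1` and all others by `0`; then
`x, a, b, y` is a proper path. -/
theorem pc_le_two_of_universal {a b : V} (hab : a ≠ b) (ha : ∀ x, x ≠ a → G.Adj x a)
    (hb : ∀ x, x ≠ b → G.Adj x b) : pc G ≤ 2 := by
  classical
  let γ : Sym2 V → Fin 2 := fun e => if e = s(a, b) then 1 else 0
  refine Nat.sInf_le ⟨fun e => γ e, fun x y hxy => ?_⟩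
  have single : ∀ {x y} (h : G.Adj x y), ∃ p : G.Walk x y,
      IsProperPath (fun e : G.edgeSet => γ e) p := fun {x y} h =>
    ⟨_, (IsProperPath.nil _ y).cons h (by simpa using h.ne) (by simp)⟩
  by_cases hxa : x = a
  · subst hxa
    exact single (ha y hxy.symm).symm
  by_cases hxb : x = b
  · subst hxb
    exact single (hb y hxy.symm).symm
  by_cases hya : y = a
  · subst hya
    exact single (ha x hxy)
  by_cases hyb : y = b
  · subst hyb
    exact single (hb x hxy)
  have hγab : γ s(a, b) = 1 := if_pos rfl
  have hγxa : γ s(x, a) = 0 := if_neg fun h => by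
    rcases Sym2.eq_iff.1 h with ⟨h, -⟩ | ⟨h, -⟩
    · exact hxa h
    · exact hxb h
  have hγby : γ s(b, y) = 0 := if_neg fun h => by
    rcases Sym2.eq_iff.1 h with ⟨-, h⟩ | ⟨-, h⟩
    · exact hyb h
    · exact hya h
  have h1 := (IsProperPath.nil (fun e : G.edgeSet => γ e) y).cons (hb y hyb).symm
    (by simpa using Ne.symm hyb) (by simp)
  have h2 := h1.cons (hb a hab) (by simp [hab, Ne.symm hya]) (by simp [hγab, hγby])
  exact ⟨_, h2.cons (ha x hxa) (by simp [hxa, hxb, hxy])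
    (by simp [hγab, hγxa, hab, Ne.symm hya])⟩

theorem IsThresholdGraph.pc_le_two [Fintype V] [DecidableRel G.Adj] [Nonempty V]
    (hδ : 2 ≤ G.minDegree) (hG : IsThresholdGraph G) : pc G ≤ 2 := by
  obtain ⟨w, t, hw⟩ := hG
  obtain ⟨m, hm⟩ := Finite.exists_min w
  have h2 : 1 < (G.neighborFinset m).card := by
    rw [SimpleGraph.card_neighborFinset_eq_degree]
    exact lt_of_lt_of_le (by omega) (G.minDegree_le_degree m)
  obtain ⟨a, ha, b, hb, hab⟩ := Finset.one_lt_card.1 h2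
  rw [SimpleGraph.mem_neighborFinset] at ha hb
  -- A neighbour of a vertex of least weight is adjacent to every other vertex.
  have huniv : ∀ a, G.Adj m a → ∀ x, x ≠ a → G.Adj x a := fun a ha x hx =>
    (hw x a hx).2 (((hw m a ha.ne).1 ha).trans (by linarith [hm x]))
  exact pc_le_two_of_universal hab (huniv a ha) (huniv b hb)

end ProperConnection

/-! ### The four graph classes -/

theorem corollary4p2 {V : Type*} [Fintype V] (G : SimpleGraph V) [DecidableRel G.Adj]
    (hconn : G.Connected) (hnc : G ≠ ⊤) (hδ : 2 ≤ G.minDegree) :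
    (ProperConnection.IsIntervalGraph G → ProperConnection.pc G ≤ 4) ∧
    (ProperConnection.IsATFree G → ProperConnection.pc G ≤ 4) ∧
    (ProperConnection.IsCircularArcGraph G → ProperConnection.pc G ≤ 4) ∧
    (ProperConnection.IsThresholdGraph G → ProperConnection.pc G = 2) := by
  have := hconn.nonempty
  exact ⟨fun h => ProperConnection.pc_le_four_of_hasDominatingPath hδ
      (h.isATFree.hasDominatingPath hconn),
    fun h => ProperConnection.pc_le_four_of_hasDominatingPath hδ (h.hasDominatingPath hconn),
    fun h => ProperConnection.pc_le_four_of_hasDominatingPath hδ (h.hasDominatingPath hconn),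
    fun h => le_antisymm (h.pc_le_two hδ) (ProperConnection.two_le_pc hconn hnc)⟩
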